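/- Let $n\ge 1$ and let $X_1,\dots,X_n$ be independent Bernoulli random variables with $\mathbb{P}(X_i=1)=p_i\in(0,1)$ and $\mathbb{P}(X_i=0)=1-p_i$. Put $W=\sum_{i=1}^n X_i$, $\mu=\mathbb{E}W$, $\mu_2=\sum_{i=1}^n p_i^2$, and $$M=\begin{cases} e^{\mu}, & 0<\mu<1,\\ e^{13/12}\sqrt{2\pi}\,(1-\mu_2/\mu)^{-1/2}, & \mu\ge 1.\end{cases}$$ Write $\mathrm{Pn}(\mu)$ for the Poisson distribution with mean $\mu$. Then for every integer $k$ with $x:=(k-\mu)/\sqrt{\mu}\ge 1$, $$\frac{\mathbb{P}(W\ge k)}{\mathrm{Pn}(\mu)([k,\infty))}-1>-2M\,\frac{\mu_2}{\mu}\left(x^2+1+4x\sqrt{\frac{1-e^{-\mu}}{\mu}}\right),$$ and, if in addition $k\ge 2$, $$\frac{\mathbb{P}(W\ge k)}{\mathrm{Pn}(\mu)([k,\infty))}-1<0.$$ No smallness of $\max_i p_i$ is assumed. -/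

import Mathlib

open MeasureTheory ProbabilityTheory

/-- The sum `W = X₁ + ⋯ + Xₙ` of `ℕ`-valued random variables. -/
def trialSum {Ω : Type*} {n : ℕ} (X : Fin n → Ω → ℕ) (ω : Ω) : ℕ := ∑ i, X i ω

/-- The constant `M`, as a function of `μ = ∑ pᵢ` and `μ₂ = ∑ pᵢ²`. -/
noncomputable def poissonBinomialM (μ μ₂ : ℝ) : ℝ :=
  if μ < 1 then Real.exp μ
  else Real.exp (13 / 12) * Real.sqrt (2 * Real.pi) * (1 - μ₂ / μ) ^ (-(1 / 2) : ℝ)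

/-- The right tail `Pn(μ)([k, ∞))` of the Poisson distribution with mean `μ ≥ 0`. -/
noncomputable def poissonTail (μ : ℝ) (k : ℤ) : ℝ :=
  (poissonMeasure μ.toNNReal).real {j : ℕ | k ≤ (j : ℤ)}

/-! The two bounds have independent proofs.

Lower bound (Stein–Chen). Let `W_i` be the sum without its `i`-th term. If `g` solves `w g(w) - μ
g(w+1) = 1[k ≤ w] - T`, with `T` the Poisson tail at `k`, then `P(W ≥ k) - T = ∑ pᵢ² E[g(W_i + 1) -
g(W_i + 2)]` (`bernoulliExp.stein`). The explicit `g` is nonincreasing from `k` on; below `k` its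
increments are `T/μ` times a polynomial `steinWeight` (`steinSol_sub_ge`). So the relative error is
controlled by `E[steinWeight(W_i); W_i + 2 ≤ k]`. For `μ < 1`, factorial moments bound this by
`2x²`; for `μ ≥ 1`, an integral representation and exponential moments give `5x²`. Both are below
`2M(x² + 1)`, so the square-root term is never needed.

Upper bound. For a fixed mean, `P(W < k)` is minimal when all success probabilities in `(0, 1)`
coincide (`exists_minimal_equal_probs`), that is, for a constant plus a binomial. A binomial
component is then traded continuously for a Poisson one of the same mean. The derivative of the
distribution function along this path is a positive multiple of a difference of consecutive weights,
negative beyond the mean by log-concavity (`binPoisson_succ_lt`). Hence `P(W < k)` exceeds its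
Poisson analogue once `k ≥ μ + 1`. -/

/-! ### Expectations over Bernoulli sums, as finite sums. -/

/-- The expectation of `h` at a sum of independent Bernoulli variables with success probabilities
`p i`, `i ∈ s`. -/
noncomputable def bernoulliExp {ι : Type*} [DecidableEq ι] (s : Finset ι) (p : ι → ℝ)
    (h : ℕ → ℝ) : ℝ :=
  ∑ t ∈ s.powerset, (∏ i ∈ t, p i) * (∏ i ∈ s \ t, (1 - p i)) * h t.card

namespace bernoulliExp

variable {ι : Type*} [DecidableEq ι] {s : Finset ι} {p : ι → ℝ}

lemma empty (p : ι → ℝ) (h : ℕ → ℝ) : bernoulliExp ∅ p h = h 0 := by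
  simp [bernoulliExp]

lemma insert {a : ι} (ha : a ∉ s) (p : ι → ℝ) (h : ℕ → ℝ) :
    bernoulliExp (insert a s) p h
      = (1 - p a) * bernoulliExp s p h + p a * bernoulliExp s p (fun w => h (w + 1)) := by
  unfold bernoulliExp
  rw [Finset.sum_powerset_insert ha, Finset.mul_sum, Finset.mul_sum]
  congr 1
  · refine Finset.sum_congr rfl fun t ht => ?_
    have hat : a ∉ t := fun h' => ha (Finset.mem_powerset.1 ht h')
    rw [Finset.insert_sdiff_of_notMem _ hat, Finset.prod_insert (by simp [ha])]
    ring
  · refine Finset.sum_congr rfl fun t ht => ?_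
    have hat : a ∉ t := fun h' => ha (Finset.mem_powerset.1 ht h')
    rw [Finset.insert_sdiff_insert, Finset.sdiff_insert_of_notMem ha, Finset.prod_insert hat,
      Finset.card_insert_of_notMem hat]
    ring

lemma erase {a : ι} (ha : a ∈ s) (p : ι → ℝ) (h : ℕ → ℝ) :
    bernoulliExp s p h = (1 - p a) * bernoulliExp (s.erase a) p h
      + p a * bernoulliExp (s.erase a) p (fun w => h (w + 1)) := by
  conv_lhs => rw [← Finset.insert_erase ha]
  exact insert (by simp) p h

lemma congr_prob {p q : ι → ℝ} (h : ℕ → ℝ) (hpq : ∀ i ∈ s, p i = q i) :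
    bernoulliExp s p h = bernoulliExp s q h := by
  unfold bernoulliExp
  refine Finset.sum_congr rfl fun t ht => ?_
  have hts := Finset.mem_powerset.1 ht
  rw [Finset.prod_congr rfl fun i (hi : i ∈ t) => hpq i (hts hi),
    Finset.prod_congr rfl fun i (hi : i ∈ s \ t) =>
      congrArg (1 - ·) (hpq i (Finset.mem_sdiff.1 hi).1)]

lemma add (p : ι → ℝ) (g h : ℕ → ℝ) :
    bernoulliExp s p (fun w => g w + h w) = bernoulliExp s p g + bernoulliExp s p h := by
  simp only [bernoulliExp, mul_add, Finset.sum_add_distrib]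

lemma sub (p : ι → ℝ) (g h : ℕ → ℝ) :
    bernoulliExp s p (fun w => g w - h w) = bernoulliExp s p g - bernoulliExp s p h := by
  simp only [bernoulliExp, mul_sub, Finset.sum_sub_distrib]

lemma const_mul (p : ι → ℝ) (c : ℝ) (h : ℕ → ℝ) :
    bernoulliExp s p (fun w => c * h w) = c * bernoulliExp s p h := by
  simp only [bernoulliExp, Finset.mul_sum]
  exact Finset.sum_congr rfl fun t _ => by ring

lemma finset_sum {κ : Type*} (u : Finset κ) (p : ι → ℝ) (g : κ → ℕ → ℝ) :
    bernoulliExp s p (fun w => ∑ j ∈ u, g j w) = ∑ j ∈ u, bernoulliExp s p (g j) := by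
  simp only [bernoulliExp, Finset.mul_sum]
  exact Finset.sum_comm

lemma const (s : Finset ι) (p : ι → ℝ) (c : ℝ) : bernoulliExp s p (fun _ => c) = c := by
  induction s using Finset.induction_on with
  | empty => exact empty _ _
  | insert a s ha ih => rw [insert ha, ih]; ring

lemma mono (hp : ∀ i ∈ s, 0 ≤ p i ∧ p i ≤ 1) {g h : ℕ → ℝ} (hgh : ∀ w, g w ≤ h w) :
    bernoulliExp s p g ≤ bernoulliExp s p h := by
  refine Finset.sum_le_sum fun t ht => mul_le_mul_of_nonneg_left (hgh _) ?_
  have hts := Finset.mem_powerset.1 ht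
  exact mul_nonneg (Finset.prod_nonneg fun i hi => (hp i (hts hi)).1)
    (Finset.prod_nonneg fun i hi => sub_nonneg.2 (hp i (Finset.mem_sdiff.1 hi).1).2)

lemma pow (s : Finset ι) (p : ι → ℝ) (z : ℝ) :
    bernoulliExp s p (fun w => z ^ w) = ∏ i ∈ s, (1 + p i * (z - 1)) := by
  induction s using Finset.induction_on with
  | empty => simp [empty]
  | insert a s ha ih =>
    have : (fun w : ℕ => z ^ (w + 1)) = fun w => z * z ^ w := by ext w; ring
    rw [insert ha, this, const_mul, ih, Finset.prod_insert ha]; ring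

lemma pow_le_exp (hp : ∀ i ∈ s, 0 ≤ p i) {z : ℝ} (hz : 1 ≤ z) :
    bernoulliExp s p (fun w => z ^ w) ≤ Real.exp ((∑ i ∈ s, p i) * (z - 1)) := by
  rw [pow, Finset.sum_mul, Real.exp_sum]
  refine Finset.prod_le_prod (fun i hi => ?_) fun i _ => ?_
  · have := mul_nonneg (hp i hi) (sub_nonneg.2 hz); linarith
  · linarith [Real.add_one_le_exp (p i * (z - 1))]

/-- The induction step is `S^(r+1) + (r+1) a S^r ≤ (S + a)^(r+1)`, a form of Bernoulli's inequality.
-/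
lemma descFactorial_le (hp : ∀ i ∈ s, 0 ≤ p i) (r : ℕ) :
    bernoulliExp s p (fun w => (w.descFactorial r : ℝ)) ≤ (∑ i ∈ s, p i) ^ r := by
  induction s using Finset.induction_on generalizing r with
  | empty => cases r <;> simp [empty]
  | insert a s ha ih =>
    have hs : ∀ i ∈ s, 0 ≤ p i := fun i hi => hp i (Finset.mem_insert_of_mem hi)
    have hpa := hp a (Finset.mem_insert_self a s)
    have hS : 0 ≤ ∑ i ∈ s, p i := Finset.sum_nonneg hs
    rw [insert ha, Finset.sum_insert ha]
    rcases r with _ | r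
    · simp [const]
    · have h1 : (fun w : ℕ => ((w + 1).descFactorial (r + 1) : ℝ))
          = fun w => (w.descFactorial (r + 1) : ℝ) + (r + 1) * (w.descFactorial r : ℝ) := by
        ext w
        rw [Nat.succ_descFactorial_succ, Nat.descFactorial_succ]
        rcases le_or_gt r w with h | h
        · push_cast [Nat.cast_sub h]; ring
        · simp [Nat.descFactorial_of_lt h]
      rw [h1, add, const_mul]
      have i1 := ih hs (r + 1)
      have i2 := ih hs r
      calc _ = bernoulliExp s p (fun w => (w.descFactorial (r + 1) : ℝ))
            + p a * ((r + 1) * bernoulliExp s p (fun w => (w.descFactorial r : ℝ))) := by ring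
        _ ≤ (∑ i ∈ s, p i) ^ (r + 1) + p a * ((r + 1) * (∑ i ∈ s, p i) ^ r) := by gcongr
        _ ≤ (p a + ∑ i ∈ s, p i) ^ (r + 1) := by
          have := pow_add_mul_le_add_pow hS (by linarith : 0 ≤ 2 * (∑ i ∈ s, p i) + p a) (r + 1)
          rw [add_comm (p a)]
          refine le_trans (le_of_eq ?_) this
          push_cast
          ring

lemma size_bias (s : Finset ι) (p : ι → ℝ) (g : ℕ → ℝ) :
    bernoulliExp s p (fun w => (w : ℝ) * g w)
      = ∑ i ∈ s, p i * bernoulliExp (s.erase i) p (fun w => g (w + 1)) := by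
  induction s using Finset.induction_on generalizing g with
  | empty => simp [empty]
  | insert a s ha ih =>
    have h1 : (fun w : ℕ => ((w + 1 : ℕ) : ℝ) * g (w + 1))
        = fun w : ℕ => (w : ℝ) * g (w + 1) + g (w + 1) := by ext w; push_cast; ring
    rw [insert ha, h1, add, ih g, ih fun w => g (w + 1), Finset.sum_insert ha,
      Finset.erase_insert ha]
    have h2 : ∑ i ∈ s, p i * bernoulliExp ((Insert.insert a s).erase i) p (fun w => g (w + 1))
        = ∑ i ∈ s, p i * ((1 - p a) * bernoulliExp (s.erase i) p (fun w => g (w + 1))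
          + p a * bernoulliExp (s.erase i) p (fun w => g (w + 1 + 1))) := by
      refine Finset.sum_congr rfl fun i hi => ?_
      have hia : a ≠ i := fun h => ha (h ▸ hi)
      rw [Finset.erase_insert_of_ne hia, insert (by simp [ha])]
    rw [h2]
    simp only [mul_add, Finset.sum_add_distrib, Finset.mul_sum]
    rw [Finset.sum_congr rfl fun i _ => mul_left_comm (1 - p a) (p i) _,
      Finset.sum_congr rfl fun i _ => mul_left_comm (p a) (p i) _]
    ring

/-- The Stein–Chen identity for sums of independent Bernoulli variables. -/
lemma stein (s : Finset ι) (p : ι → ℝ) (g : ℕ → ℝ) :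
    bernoulliExp s p (fun w => (w : ℝ) * g w - (∑ i ∈ s, p i) * g (w + 1))
      = ∑ i ∈ s, p i ^ 2 * bernoulliExp (s.erase i) p (fun w => g (w + 1) - g (w + 2)) := by
  rw [sub, size_bias, const_mul, Finset.sum_mul, ← Finset.sum_sub_distrib]
  refine Finset.sum_congr rfl fun i hi => ?_
  rw [erase hi p fun w => g (w + 1), sub]
  ring

lemma continuous (s : Finset ι) (h : ℕ → ℝ) :
    Continuous fun p : ι → ℝ => bernoulliExp s p h := by
  unfold bernoulliExp
  fun_prop

end bernoulliExp

/-! ### From random variables to `bernoulliExp`. -/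

open Classical in
/-- The law of a sum of independent Bernoulli variables, in terms of `bernoulliExp`. -/
lemma measureReal_sum_bernoulli {Ω ι : Type*} [MeasurableSpace Ω] {P : Measure Ω}
    [IsProbabilityMeasure P] {p : ι → unitInterval} {X : ι → Ω → ℕ}
    (hX : ∀ i, HasLaw (X i) (bernoulliMeasure (1 : ℕ) 0 (p i)) P) (hindep : iIndepFun X P)
    (s : Finset ι) (A : Set ℕ) :
    P.real {ω | ∑ i ∈ s, X i ω ∈ A}
      = bernoulliExp s (fun i => (p i : ℝ)) (fun w => if w ∈ A then 1 else 0) := by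
  induction s using Finset.induction_on generalizing A with
  | empty =>
    rw [bernoulliExp.empty]
    by_cases h : 0 ∈ A <;> simp [h]
  | insert a s ha ih =>
    rw [bernoulliExp.insert ha, ← ih A]
    have ih1 := ih {w | w + 1 ∈ A}
    simp only [Set.mem_ofPred_eq] at ih1
    rw [← ih1]
    have hind : (fun ω => ∑ i ∈ s, X i ω) ⟂ᵢ[P] X a := by
      have := hindep.indepFun_finsetSum_of_notMem₀ (fun i => (hX i).aemeasurable) ha
      convert this using 1
      ext ω; simp
    have hae : ∀ᵐ ω ∂P, X a ω = 0 ∨ X a ω = 1 := by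
      rw [(hX a).ae_iff (p := fun x => x = 0 ∨ x = 1) (by fun_prop), ae_iff]
      rw [bernoulliMeasure_apply_of_notMem_of_notMem] <;> simp
    have hlaw : ∀ c : ℕ, P.real (X a ⁻¹' {c}) = (bernoulliMeasure (1 : ℕ) 0 (p a)).real {c} :=
      fun c => (hX a).measureReal_eq (p := fun x => x ∈ ({c} : Set ℕ)) trivial
    have key : ∀ (c : ℕ) (B : Set ℕ), P.real ({ω | ∑ i ∈ s, X i ω ∈ B} ∩ X a ⁻¹' {c})
        = P.real {ω | ∑ i ∈ s, X i ω ∈ B} * (bernoulliMeasure (1 : ℕ) 0 (p a)).real {c} := by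
      intro c B
      rw [← hlaw c]
      have := hind.measure_inter_preimage_eq_mul B {c} trivial trivial
      simp only [Measure.real, ← ENNReal.toReal_mul]
      exact congrArg _ this
    have h0 := key 0 A
    have h1 := key 1 {w | w + 1 ∈ A}
    rw [bernoulliMeasure_real_apply_of_notMem_of_mem _ (by trivial) (by simp) (by simp)] at h0
    rw [bernoulliMeasure_real_apply_of_mem_of_notMem _ (by trivial) (by simp) (by simp)] at h1
    have hm : ∀ c, NullMeasurableSet (X a ⁻¹' {c}) P := fun c =>
      (hX a).aemeasurable.nullMeasurable (by trivial)
    have hS : NullMeasurableSet {ω | ∑ i ∈ s, X i ω ∈ {w | w + 1 ∈ A}} P := by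
      have : AEMeasurable (fun ω => ∑ i ∈ s, X i ω) P :=
        Finset.aemeasurable_fun_sum s fun i _ => (hX i).aemeasurable
      exact this.nullMeasurable (by trivial)
    have hsplit : P.real {ω | ∑ i ∈ Insert.insert a s, X i ω ∈ A} =
        P.real (({ω | ∑ i ∈ s, X i ω ∈ A} ∩ X a ⁻¹' {0})
          ∪ ({ω | ∑ i ∈ s, X i ω ∈ {w | w + 1 ∈ A}} ∩ X a ⁻¹' {1})) := by
      refine measureReal_congr (Filter.eventuallyEq_set.2 ?_)
      filter_upwards [hae] with ω hω
      change (∑ i ∈ Insert.insert a s, X i ω ∈ A) ↔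
        (∑ i ∈ s, X i ω ∈ A ∧ X a ω = 0) ∨ (∑ i ∈ s, X i ω + 1 ∈ A ∧ X a ω = 1)
      rw [Finset.sum_insert ha]
      rcases hω with h | h <;> simp [h, add_comm]
    rw [hsplit, measureReal_union₀ (hS.inter (hm 1)), h0, h1]
    · simp; ring
    · refine Disjoint.aedisjoint (Set.disjoint_left.2 ?_)
      rintro ω ⟨_, h⟩ ⟨_, h'⟩
      simp at h h'
      omega

/-! ### Poisson weights and tails. -/

/-- The Poisson weight `e^{-θ} θ^n / n!`. -/
noncomputable def poissonWeight (θ : ℝ) (n : ℕ) : ℝ := Real.exp (-θ) * θ ^ n / n.factorial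

/-- The probability that a Poisson variable of mean `θ` is less than `k`. -/
noncomputable def poissonCdf (θ : ℝ) (k : ℕ) : ℝ := ∑ n ∈ Finset.range k, poissonWeight θ n

lemma poissonWeight_pos {θ : ℝ} (hθ : 0 < θ) (n : ℕ) : 0 < poissonWeight θ n := by
  unfold poissonWeight; positivity

lemma poissonWeight_nonneg {θ : ℝ} (hθ : 0 ≤ θ) (n : ℕ) : 0 ≤ poissonWeight θ n := by
  unfold poissonWeight; positivity

lemma succ_mul_poissonWeight_succ (θ : ℝ) (n : ℕ) :
    (n + 1) * poissonWeight θ (n + 1) = θ * poissonWeight θ n := by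
  unfold poissonWeight
  rw [Nat.factorial_succ]
  push_cast
  field_simp
  ring

lemma hasSum_poissonWeight {θ : ℝ} (hθ : 0 ≤ θ) : HasSum (poissonWeight θ) 1 := by
  have h := hasSum_one_poissonMeasure θ.toNNReal
  rwa [Real.coe_toNNReal _ hθ] at h

lemma poissonCdf_succ (θ : ℝ) (k : ℕ) :
    poissonCdf θ (k + 1) = poissonCdf θ k + poissonWeight θ k := Finset.sum_range_succ _ _

lemma poissonCdf_nonneg {θ : ℝ} (hθ : 0 ≤ θ) (k : ℕ) : 0 ≤ poissonCdf θ k :=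
  Finset.sum_nonneg fun n _ => poissonWeight_nonneg hθ n

lemma hasSum_poissonWeight_add {θ : ℝ} (hθ : 0 ≤ θ) (k : ℕ) :
    HasSum (fun n => poissonWeight θ (n + k)) (1 - poissonCdf θ k) :=
  (hasSum_nat_add_iff' k).2 (hasSum_poissonWeight hθ)

lemma poissonCdf_lt_one {θ : ℝ} (hθ : 0 < θ) (k : ℕ) : poissonCdf θ k < 1 := by
  have h := hasSum_poissonWeight_add hθ.le k
  have h0 := h.summable.tsum_pos (fun n => (poissonWeight_pos hθ _).le) 0 (poissonWeight_pos hθ _)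
  rw [h.tsum_eq] at h0
  linarith

/-- Termwise, `(k+1) π(n+k+1) ≤ (n+k+1) π(n+k+1) = θ π(n+k)`. -/
lemma mul_poissonTail_succ_le {θ : ℝ} (hθ : 0 ≤ θ) (k : ℕ) :
    (k + 1) * (1 - poissonCdf θ (k + 1)) ≤ θ * (1 - poissonCdf θ k) := by
  refine hasSum_le (fun n => ?_) ((hasSum_poissonWeight_add hθ (k + 1)).mul_left ((k : ℝ) + 1))
    ((hasSum_poissonWeight_add hθ k).mul_left θ)
  rw [← succ_mul_poissonWeight_succ θ (n + k), ← add_assoc]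
  have := poissonWeight_nonneg hθ (n + k + 1)
  gcongr
  linarith [(Nat.cast_nonneg n : (0 : ℝ) ≤ n)]

lemma poissonTail_natCast {θ : ℝ} (hθ : 0 ≤ θ) (k : ℕ) :
    poissonTail θ (k : ℤ) = 1 - poissonCdf θ k := by
  have hset : {j : ℕ | (k : ℤ) ≤ (j : ℤ)} = ((Finset.range k : Finset ℕ) : Set ℕ)ᶜ := by
    ext j; simp
  rw [poissonTail, hset, probReal_compl_eq_one_sub (Finset.measurableSet _),
    ← sum_measureReal_singleton, poissonCdf]
  simp only [poissonMeasure_real_singleton, Real.coe_toNNReal _ hθ, poissonWeight]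

/-! ### The Stein–Chen equation for a tail event. -/

/-- The coefficients in the Stein–Chen error term for tail events. -/
noncomputable def steinWeight (μ : ℝ) (w : ℕ) : ℝ :=
  ∑ i ∈ Finset.range (w + 1), (i + 1) * (w.descFactorial i : ℝ) / μ ^ (i + 1)

lemma poissonCdf_succ_div_poissonWeight {μ : ℝ} (hμ : 0 < μ) (w : ℕ) :
    poissonCdf μ (w + 1) / poissonWeight μ w
      = ∑ i ∈ Finset.range (w + 1), (w.descFactorial i : ℝ) / μ ^ i := by
  rw [poissonCdf, ← Finset.sum_range_reflect, Finset.sum_div]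
  refine Finset.sum_congr rfl fun i hi => ?_
  have hi' : i ≤ w := Nat.lt_succ_iff.1 (Finset.mem_range.1 hi)
  have h1 : ((w - i).factorial : ℝ) * w.descFactorial i = w.factorial := by
    exact_mod_cast Nat.factorial_mul_descFactorial hi'
  have h2 : μ ^ (w - i) * μ ^ i = μ ^ w := by rw [← pow_add, Nat.sub_add_cancel hi']
  have h3 : w + 1 - 1 - i = w - i := by omega
  have h4 : ((w - i).factorial : ℝ) ≠ 0 := by positivity
  have h5 : (w.factorial : ℝ) ≠ 0 := by positivity
  have h6 := Real.exp_pos (-μ)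
  rw [h3, poissonWeight, poissonWeight, ← h2]
  field_simp
  rw [← h1]

/-- Increments of the ratio in `poissonCdf_succ_div_poissonWeight`: the falling factorials satisfy
`(w+1)_{i+1} - w_{i+1} = (i+1) w_i`. -/
lemma steinWeight_eq {μ : ℝ} (hμ : 0 < μ) (w : ℕ) :
    steinWeight μ w = poissonCdf μ (w + 2) / poissonWeight μ (w + 1)
      - poissonCdf μ (w + 1) / poissonWeight μ w := by
  have h0 : ∑ i ∈ Finset.range (w + 1), (w.descFactorial i : ℝ) / μ ^ i
      = ∑ i ∈ Finset.range (w + 2), (w.descFactorial i : ℝ) / μ ^ i := by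
    rw [Finset.sum_range_succ _ (w + 1)]
    simp
  rw [poissonCdf_succ_div_poissonWeight hμ w, poissonCdf_succ_div_poissonWeight hμ (w + 1), h0,
    Finset.sum_range_succ' _ (w + 1), Finset.sum_range_succ' _ (w + 1), add_sub_add_comm,
    ← Finset.sum_sub_distrib, steinWeight]
  simp only [Nat.descFactorial_zero, sub_self, add_zero]
  refine Finset.sum_congr rfl fun i hi => ?_
  have hi' : i ≤ w := Nat.lt_succ_iff.1 (Finset.mem_range.1 hi)
  rw [← sub_div, Nat.succ_descFactorial_succ, Nat.descFactorial_succ]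
  push_cast [Nat.cast_sub hi']
  congr 1
  ring

/-- The solution of the Stein–Chen equation for the tail event `[k, ∞)`, up to sign. -/
noncomputable def steinSol (μ : ℝ) (k j : ℕ) : ℝ :=
  (if j ≤ k then (1 - poissonCdf μ k) * poissonCdf μ j
    else poissonCdf μ k * (1 - poissonCdf μ j)) / (μ * poissonWeight μ (j - 1))

lemma steinSol_equation {μ : ℝ} (hμ : 0 < μ) {k : ℕ} (hk : 1 ≤ k) (w : ℕ) :
    (w : ℝ) * steinSol μ k w - μ * steinSol μ k (w + 1)
      = (if k ≤ w then 1 else 0) - (1 - poissonCdf μ k) := by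
  -- The factor `w` turns the denominator `μ π(w-1) = w π(w)` into `π(w)`. At `w = 0` the truncated
  -- `w - 1` is harmless, as both sides vanish.
  have hmul : (w : ℝ) * steinSol μ k w = (if w ≤ k then (1 - poissonCdf μ k) * poissonCdf μ w
      else poissonCdf μ k * (1 - poissonCdf μ w)) / poissonWeight μ w := by
    rcases w with _ | w
    · simp [poissonCdf]
    · have h1 := succ_mul_poissonWeight_succ μ w
      have h2 := poissonWeight_pos hμ (w + 1)
      rw [steinSol, Nat.add_sub_cancel, ← h1]
      push_cast
      field_simp
  have hp := poissonWeight_pos hμ w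
  rw [hmul, steinSol, Nat.add_sub_cancel, poissonCdf_succ]
  rcases lt_trichotomy w k with h | h | h
  · rw [if_pos h.le, if_pos (by omega), if_neg (by omega)]
    field_simp; ring
  · subst h
    rw [if_pos le_rfl, if_neg (by omega), if_pos le_rfl]
    field_simp; ring
  · rw [if_neg (by omega), if_neg (by omega), if_pos h.le]
    field_simp; ring

/-- The ratio of the tail beyond `w` to `π(w)` is nonincreasing; this makes `steinSol` nonincreasing
from `k` on. -/
lemma poissonTail_mul_poissonWeight_le {μ : ℝ} (hμ : 0 < μ) (w : ℕ) :
    (1 - poissonCdf μ (w + 2)) * poissonWeight μ w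
      ≤ (1 - poissonCdf μ (w + 1)) * poissonWeight μ (w + 1) := by
  have h1 := succ_mul_poissonWeight_succ μ w
  have hT : 0 < 1 - poissonCdf μ (w + 2) := sub_pos.2 (poissonCdf_lt_one hμ _)
  have h2 := mul_poissonTail_succ_le hμ.le (w + 1)
  push_cast at h2
  have h3 : (w + 1) * (1 - poissonCdf μ (w + 2)) ≤ μ * (1 - poissonCdf μ (w + 1)) := by
    linarith
  have := mul_le_mul_of_nonneg_right h3 (poissonWeight_pos hμ (w + 1)).le
  nlinarith

lemma steinSol_sub_ge {μ : ℝ} (hμ : 0 < μ) (k w : ℕ) :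
    -((1 - poissonCdf μ k) / μ * (if w + 2 ≤ k then steinWeight μ w else 0))
      ≤ steinSol μ k (w + 1) - steinSol μ k (w + 2) := by
  have hp := poissonWeight_pos hμ w
  have hp1 := poissonWeight_pos hμ (w + 1)
  rw [steinSol, steinSol, Nat.add_sub_cancel, show w + 2 - 1 = w + 1 by omega]
  split_ifs with h1 h2 h3
  · rw [steinWeight_eq hμ]
    apply le_of_eq
    field_simp; ring
  · omega
  · obtain rfl : k = w + 1 := by omega
    rw [mul_zero, neg_zero, sub_nonneg, div_le_div_iff₀ (by positivity) (by positivity)]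
    nlinarith [mul_le_mul_of_nonneg_left (poissonTail_mul_poissonWeight_le hμ w)
      (mul_nonneg (poissonCdf_nonneg hμ.le (w + 1)) hμ.le)]
  · rw [mul_zero, neg_zero, sub_nonneg, div_le_div_iff₀ (by positivity) (by positivity)]
    nlinarith [mul_le_mul_of_nonneg_left (poissonTail_mul_poissonWeight_le hμ w)
      (mul_nonneg (poissonCdf_nonneg hμ.le k) hμ.le)]

lemma bernoulliExp_tail_ge {ι : Type*} [DecidableEq ι] {s : Finset ι} {p : ι → ℝ}
    (hp : ∀ i ∈ s, 0 ≤ p i ∧ p i ≤ 1) (hμ : 0 < ∑ i ∈ s, p i) {k : ℕ} (hk : 1 ≤ k) :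
    (1 - poissonCdf (∑ i ∈ s, p i) k) * (1 - (∑ i ∈ s, p i)⁻¹ * ∑ i ∈ s, p i ^ 2 *
        bernoulliExp (s.erase i) p
          (fun w => if w + 2 ≤ k then steinWeight (∑ i ∈ s, p i) w else 0))
      ≤ bernoulliExp s p (fun w => if k ≤ w then 1 else 0) := by
  set μ := ∑ i ∈ s, p i with hμdef
  have h := bernoulliExp.stein s p (steinSol μ k)
  rw [← hμdef] at h
  simp only [steinSol_equation hμ hk] at h
  rw [bernoulliExp.sub, bernoulliExp.const] at h
  have h2 : ∑ i ∈ s, p i ^ 2 * (-((1 - poissonCdf μ k) / μ * bernoulliExp (s.erase i) p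
        (fun w => if w + 2 ≤ k then steinWeight μ w else 0)))
      ≤ ∑ i ∈ s, p i ^ 2 * bernoulliExp (s.erase i) p
          (fun w => steinSol μ k (w + 1) - steinSol μ k (w + 2)) := by
    refine Finset.sum_le_sum fun i _ => mul_le_mul_of_nonneg_left ?_ (sq_nonneg _)
    rw [← neg_mul, ← bernoulliExp.const_mul]
    refine bernoulliExp.mono (fun j hj => hp j (Finset.mem_of_mem_erase hj)) fun w => ?_
    rw [neg_mul]
    exact steinSol_sub_ge hμ k w
  rw [← h] at h2
  have h3 : ∑ i ∈ s, p i ^ 2 * (-((1 - poissonCdf μ k) / μ * bernoulliExp (s.erase i) p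
        (fun w => if w + 2 ≤ k then steinWeight μ w else 0)))
      = -((1 - poissonCdf μ k) * (μ⁻¹ * ∑ i ∈ s, p i ^ 2 * bernoulliExp (s.erase i) p
        (fun w => if w + 2 ≤ k then steinWeight μ w else 0))) := by
    rw [Finset.mul_sum, Finset.mul_sum, ← Finset.sum_neg_distrib]
    exact Finset.sum_congr rfl fun i _ => by ring
  rw [h3] at h2
  linarith

/-! ### Integral representation of `steinWeight`. -/

lemma integrableOn_exp_neg_mul_pow (n : ℕ) :
    IntegrableOn (fun t : ℝ => Real.exp (-t) * t ^ n) (Set.Ioi 0) := by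
  have h := Real.GammaIntegral_convergent (s := n + 1) (by positivity)
  simpa using h

lemma integral_exp_neg_mul_pow (n : ℕ) :
    ∫ t in Set.Ioi (0 : ℝ), Real.exp (-t) * t ^ n = n.factorial := by
  have h := Real.Gamma_eq_integral (s := n + 1) (by positivity)
  rw [Real.Gamma_nat_eq_factorial] at h
  simpa using h.symm

lemma exp_neg_mul_pow_expand (μ : ℝ) (w : ℕ) (t : ℝ) :
    Real.exp (-t) * (1 + t / μ) ^ w * (t / μ)
      = ∑ i ∈ Finset.range (w + 1),
        (w.choose i / μ ^ (i + 1)) * (Real.exp (-t) * t ^ (i + 1)) := by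
  rw [add_comm 1, add_pow, Finset.mul_sum, Finset.sum_mul]
  refine Finset.sum_congr rfl fun i _ => ?_
  rw [div_pow]
  ring

lemma integrableOn_steinIntegrand (μ : ℝ) (w : ℕ) :
    IntegrableOn (fun t : ℝ => Real.exp (-t) * (1 + t / μ) ^ w * (t / μ)) (Set.Ioi 0) := by
  simp only [exp_neg_mul_pow_expand]
  exact integrable_finsetSum _ fun i _ => (integrableOn_exp_neg_mul_pow (i + 1)).const_mul _

/-- Binomial expansion and Gamma integrals. The variable `w` now occurs only as an exponent, so
expectations reduce to generating functions. -/
lemma steinWeight_eq_integral (μ : ℝ) (w : ℕ) :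
    steinWeight μ w = ∫ t in Set.Ioi (0 : ℝ), Real.exp (-t) * (1 + t / μ) ^ w * (t / μ) := by
  simp only [exp_neg_mul_pow_expand]
  rw [integral_finsetSum _ fun i _ => (integrableOn_exp_neg_mul_pow (i + 1)).const_mul _,
    steinWeight]
  refine Finset.sum_congr rfl fun i _ => ?_
  rw [integral_const_mul, integral_exp_neg_mul_pow, Nat.descFactorial_eq_factorial_mul_choose,
    Nat.factorial_succ]
  push_cast
  ring

lemma integral_Ioi_mul_exp {R τ : ℝ} (hR : 0 < R) (hτ : 0 ≤ τ) :
    IntegrableOn (fun t => t * Real.exp (-((t - τ) / R))) (Set.Ioi τ) ∧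
    ∫ t in Set.Ioi τ, t * Real.exp (-((t - τ) / R)) = τ * R + R ^ 2 := by
  have hderiv : ∀ t ∈ Set.Ici τ, HasDerivAt
      (fun t => -(t * R + R ^ 2) * Real.exp (-((t - τ) / R)))
      (t * Real.exp (-((t - τ) / R))) t := by
    intro t _
    have h1 : HasDerivAt (fun t : ℝ => -(t * R + R ^ 2)) (-(1 * R)) t :=
      (((hasDerivAt_id t).mul_const R).add_const _).neg
    have h2 : HasDerivAt (fun t : ℝ => -((t - τ) / R)) (-(1 / R)) t :=
      (((hasDerivAt_id t).sub_const τ).div_const R).neg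
    refine (h1.mul h2.exp).congr_deriv ?_
    field_simp
    ring
  have hpos : ∀ t ∈ Set.Ioi τ, 0 ≤ t * Real.exp (-((t - τ) / R)) := fun t ht =>
    mul_nonneg (hτ.trans (le_of_lt ht)) (Real.exp_pos _).le
  have hlim : Filter.Tendsto (fun t => -(t * R + R ^ 2) * Real.exp (-((t - τ) / R)))
      Filter.atTop (nhds 0) := by
    have hu : Filter.Tendsto (fun t : ℝ => (t - τ) / R) Filter.atTop Filter.atTop :=
      (Filter.tendsto_atTop_add_const_right _ (-τ) Filter.tendsto_id).atTop_div_const hR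
    have h1 := (Real.tendsto_pow_mul_exp_neg_atTop_nhds_zero 1).comp hu
    have h0 := (Real.tendsto_pow_mul_exp_neg_atTop_nhds_zero 0).comp hu
    have := (h1.const_mul (-R ^ 2)).add (h0.const_mul (-(τ * R + R ^ 2)))
    simp only [mul_zero, add_zero] at this
    refine this.congr fun t => ?_
    simp only [Function.comp]
    field_simp
    ring
  refine ⟨integrableOn_Ioi_deriv_of_nonneg' hderiv hpos hlim, ?_⟩
  rw [integral_Ioi_of_hasDerivAt_of_nonneg' hderiv hpos hlim]
  simp

lemma pow_le_tilted {μ τ t : ℝ} (hμ : 0 < μ) (hτ : 0 ≤ τ) (ht : τ ≤ t) {w N : ℕ} (hw : w ≤ N) :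
    (1 + t / μ) ^ w ≤ (1 + τ / μ) ^ w * Real.exp ((t - τ) / (μ + τ) * N) := by
  have h1 : 1 + t / μ = (1 + τ / μ) * (1 + (t - τ) / (μ + τ)) := by
    have : μ + τ ≠ 0 := by positivity
    field_simp
    ring
  have h2 : 0 ≤ (t - τ) / (μ + τ) := div_nonneg (sub_nonneg.2 ht) (by positivity)
  rw [h1, mul_pow]
  gcongr
  calc (1 + (t - τ) / (μ + τ)) ^ w ≤ (1 + (t - τ) / (μ + τ)) ^ N :=
        pow_le_pow_right₀ (by linarith) hw
    _ ≤ Real.exp ((t - τ) / (μ + τ)) ^ N := by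
        gcongr
        linarith [Real.add_one_le_exp ((t - τ) / (μ + τ))]
    _ = _ := by rw [← Real.exp_nat_mul, mul_comm]

/-- Beyond `τ`, the bound `1 + u ≤ exp u` applied after factoring out `1 + τ/μ` leaves an integrand
with exponential decay rate `1/R = 1 - N/(μ + τ)`, which integrates exactly. -/
lemma steinWeight_le {μ τ : ℝ} (hμ : 0 < μ) (hτ : 0 ≤ τ) {w N : ℕ} (hw : w ≤ N)
    (hN : (N : ℝ) < μ + τ) {R : ℝ} (hR : R = (μ + τ) / (μ + τ - N)) :
    steinWeight μ w ≤ (∫ t in (0 : ℝ)..τ, Real.exp (-t) * (t / μ) * (1 + t / μ) ^ w)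
      + Real.exp (-τ) * ((τ * R + R ^ 2) / μ) * (1 + τ / μ) ^ w := by
  have hRpos : 0 < R := by rw [hR]; exact div_pos (by positivity) (sub_pos.2 hN)
  obtain ⟨hi, hI⟩ := integral_Ioi_mul_exp hRpos hτ
  have hint := integrableOn_steinIntegrand μ w
  have hsub : Set.Ioi τ ⊆ Set.Ioi 0 := Set.Ioi_subset_Ioi hτ
  rw [steinWeight_eq_integral, ← Set.Ioc_union_Ioi_eq_Ioi hτ,
    setIntegral_union (Set.Ioc_disjoint_Ioi le_rfl) measurableSet_Ioi
      (hint.mono_set Set.Ioc_subset_Ioi_self) (hint.mono_set hsub),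
    intervalIntegral.integral_of_le hτ]
  refine add_le_add (le_of_eq (integral_congr_ae (ae_of_all _ fun t => by ring))) ?_
  have hconst : Real.exp (-τ) * ((τ * R + R ^ 2) / μ) * (1 + τ / μ) ^ w
      = ∫ t in Set.Ioi τ, (Real.exp (-τ) * (1 + τ / μ) ^ w / μ)
        * (t * Real.exp (-((t - τ) / R))) := by
    rw [integral_const_mul, hI]
    ring
  rw [hconst]
  refine setIntegral_mono_on (hint.mono_set hsub) (hi.const_mul _) measurableSet_Ioi fun t ht => ?_
  have ht' : τ < t := ht
  have hexp : Real.exp (-t) * Real.exp ((t - τ) / (μ + τ) * N)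
      = Real.exp (-τ) * Real.exp (-((t - τ) / R)) := by
    rw [← Real.exp_add, ← Real.exp_add, hR]
    congr 1
    have h1 : μ + τ ≠ 0 := by positivity
    have h2 : μ + τ - N ≠ 0 := (sub_pos.2 hN).ne'
    field_simp
    ring
  have htμ : 0 ≤ t / μ := div_nonneg (hτ.trans ht'.le) hμ.le
  calc Real.exp (-t) * (1 + t / μ) ^ w * (t / μ)
      ≤ Real.exp (-t) * ((1 + τ / μ) ^ w * Real.exp ((t - τ) / (μ + τ) * N)) * (t / μ) := by
        gcongr
        exact pow_le_tilted hμ hτ ht'.le hw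
    _ = (Real.exp (-t) * Real.exp ((t - τ) / (μ + τ) * N)) * ((1 + τ / μ) ^ w * (t / μ)) := by
        ring
    _ = _ := by rw [hexp]; ring

/-! ### Expected size of the Stein–Chen error. -/

namespace bernoulliExp

variable {ι : Type*} [DecidableEq ι] {s : Finset ι} {p : ι → ℝ}

lemma pow_le_exp_div (hp : ∀ i ∈ s, 0 ≤ p i) {μ t : ℝ} (hμ : 0 < μ) (hs : ∑ i ∈ s, p i ≤ μ)
    (ht : 0 ≤ t) : bernoulliExp s p (fun w => (1 + t / μ) ^ w) ≤ Real.exp t := by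
  have h := div_nonneg ht hμ.le
  refine (pow_le_exp hp (by linarith)).trans (Real.exp_le_exp.2 ?_)
  calc (∑ i ∈ s, p i) * (1 + t / μ - 1) ≤ μ * (1 + t / μ - 1) := by gcongr; linarith
    _ = t := by field_simp; ring

lemma integral (a b : ℝ) (g : ℝ → ℕ → ℝ) (hg : ∀ w, Continuous fun t => g t w) :
    bernoulliExp s p (fun w => ∫ t in a..b, g t w) = ∫ t in a..b, bernoulliExp s p (g t) := by
  unfold bernoulliExp
  rw [intervalIntegral.integral_finsetSum fun t _ =>
    ((hg t.card).intervalIntegrable a b).const_mul _]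
  simp only [intervalIntegral.integral_const_mul]

/-- Splitting the integral representation of `steinWeight` at `τ`. -/
lemma steinWeight_le_of_tilt (hp : ∀ i ∈ s, 0 ≤ p i ∧ p i ≤ 1) {μ τ : ℝ} (hμ : 0 < μ)
    (hs : ∑ i ∈ s, p i ≤ μ) (hτ : 0 ≤ τ) {k : ℕ} (hk : 2 ≤ k) (hkτ : (k : ℝ) - 2 < μ + τ)
    {R : ℝ} (hR : R = (μ + τ) / (μ + τ - (k - 2))) :
    bernoulliExp s p (fun w => if w + 2 ≤ k then steinWeight μ w else 0)
      ≤ (τ ^ 2 / 2 + τ * R + R ^ 2) / μ := by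
  obtain ⟨N, rfl⟩ := Nat.exists_eq_add_of_le' hk
  push_cast at hkτ hR
  rw [add_sub_cancel_right] at hkτ hR
  have hRpos : 0 < R := by rw [hR]; exact div_pos (by positivity) (sub_pos.2 hkτ)
  have hp0 : ∀ i ∈ s, 0 ≤ p i := fun i hi => (hp i hi).1
  have hcont : ∀ w : ℕ, Continuous fun t : ℝ => Real.exp (-t) * (t / μ) * (1 + t / μ) ^ w := by
    intro w; fun_prop
  have h1 : bernoulliExp s p (fun w => if w + 2 ≤ N + 2 then steinWeight μ w else 0)
      ≤ bernoulliExp s p (fun w => (∫ t in (0 : ℝ)..τ, Real.exp (-t) * (t / μ) * (1 + t / μ) ^ w)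
        + Real.exp (-τ) * ((τ * R + R ^ 2) / μ) * (1 + τ / μ) ^ w) := by
    refine mono hp fun w => ?_
    split_ifs with h
    · exact steinWeight_le hμ hτ (by omega) hkτ hR
    · refine add_nonneg (intervalIntegral.integral_nonneg hτ fun t ht => ?_) (by positivity)
      have := div_nonneg ht.1 hμ.le
      positivity
  refine h1.trans ?_
  rw [add, integral _ _ _ hcont, const_mul]
  -- Below `τ`, the factor `exp (-t)` cancels the exponential moment bound `E (1 + t/μ)^W ≤ exp t`.
  have h2 : ∫ t in (0 : ℝ)..τ,
      bernoulliExp s p (fun w => Real.exp (-t) * (t / μ) * (1 + t / μ) ^ w)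
      ≤ ∫ t in (0 : ℝ)..τ, t / μ := by
    refine intervalIntegral.integral_mono_on hτ ?_ ?_ fun t ht => ?_
    · refine Continuous.intervalIntegrable ?_ _ _
      unfold bernoulliExp
      fun_prop
    · exact (continuous_id.div_const μ).intervalIntegrable _ _
    · have h3 := div_nonneg ht.1 hμ.le
      rw [const_mul]
      calc _ ≤ Real.exp (-t) * (t / μ) * Real.exp t := by
            gcongr
            exact pow_le_exp_div hp0 hμ hs ht.1
        _ = t / μ := by
            rw [mul_right_comm, ← Real.exp_add]; simp
  have h4 : Real.exp (-τ) * ((τ * R + R ^ 2) / μ) * bernoulliExp s p (fun w => (1 + τ / μ) ^ w)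
      ≤ (τ * R + R ^ 2) / μ := by
    calc _ ≤ Real.exp (-τ) * ((τ * R + R ^ 2) / μ) * Real.exp τ := by
          gcongr
          exact pow_le_exp_div hp0 hμ hs hτ
      _ = _ := by rw [mul_right_comm, ← Real.exp_add]; simp
  have h5 : ∫ t in (0 : ℝ)..τ, t / μ = τ ^ 2 / 2 / μ := by
    rw [intervalIntegral.integral_div, integral_id]; simp
  calc _ ≤ τ ^ 2 / 2 / μ + (τ * R + R ^ 2) / μ := by rw [← h5]; exact add_le_add h2 h4
    _ = _ := by ring

/-- The truncation leaves only the terms `i < k` of `steinWeight`, each of expectation at most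
`(i+1)/μ`. -/
lemma steinWeight_le_of_moments (hp : ∀ i ∈ s, 0 ≤ p i ∧ p i ≤ 1) {μ : ℝ} (hμ : 0 < μ)
    (hs : ∑ i ∈ s, p i ≤ μ) (k : ℕ) :
    bernoulliExp s p (fun w => if w + 2 ≤ k + 1 then steinWeight μ w else 0)
      ≤ k * (k + 1) / 2 / μ := by
  have h1 : bernoulliExp s p (fun w => if w + 2 ≤ k + 1 then steinWeight μ w else 0)
      ≤ bernoulliExp s p (fun w => ∑ i ∈ Finset.range k,
        (i + 1) / μ ^ (i + 1) * (w.descFactorial i : ℝ)) := by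
    refine mono hp fun w => ?_
    split_ifs with h
    · rw [steinWeight, Finset.sum_congr rfl fun i _ => mul_div_right_comm _ _ _]
      exact Finset.sum_le_sum_of_subset_of_nonneg (Finset.range_subset_range.2 (by omega))
        fun i _ _ => by positivity
    · exact Finset.sum_nonneg fun i _ => by positivity
  refine h1.trans ?_
  rw [finset_sum]
  have hS : 0 ≤ ∑ i ∈ s, p i := Finset.sum_nonneg fun i hi => (hp i hi).1
  have h2 : ∀ i ∈ Finset.range k, bernoulliExp s p (fun w => (i + 1) / μ ^ (i + 1) *
      (w.descFactorial i : ℝ)) ≤ (i + 1) / μ := by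
    intro i _
    rw [const_mul]
    calc _ ≤ ((i : ℝ) + 1) / μ ^ (i + 1) * μ ^ i := by
          gcongr
          exact (descFactorial_le (fun i hi => (hp i hi).1) i).trans
            (pow_le_pow_left₀ hS hs i)
      _ = _ := by rw [pow_succ]; field_simp
  refine (Finset.sum_le_sum h2).trans (le_of_eq ?_)
  rw [← Finset.sum_div]
  congr 1
  clear h1 h2
  induction k with
  | zero => simp
  | succ k ih => rw [Finset.sum_range_succ, ih]; push_cast; ring

end bernoulliExp

lemma steinWeight_expectation_le_of_lt_one {ι : Type*} [DecidableEq ι] {s : Finset ι} {p : ι → ℝ}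
    (hp : ∀ i ∈ s, 0 ≤ p i ∧ p i ≤ 1) {μ : ℝ} (hμ : 0 < μ) (hμ1 : μ < 1)
    (hs : ∑ i ∈ s, p i ≤ μ) {k : ℕ} (hk : 1 ≤ k) :
    bernoulliExp s p (fun w => if w + 2 ≤ k then steinWeight μ w else 0)
      ≤ 2 * (((k : ℝ) - μ) ^ 2 / μ) := by
  obtain ⟨N, rfl⟩ := Nat.exists_eq_add_of_le' hk
  refine (bernoulliExp.steinWeight_le_of_moments hp hμ hs N).trans ?_
  rw [← mul_div_assoc]
  gcongr
  push_cast
  have h2 : (N : ℝ) * (N + 1) ≤ 4 * (N : ℝ) ^ 2 := by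
    rcases N with _ | N
    · simp
    · push_cast
      nlinarith [(Nat.cast_nonneg N : (0 : ℝ) ≤ N)]
  nlinarith [(Nat.cast_nonneg N : (0 : ℝ) ≤ N)]

lemma steinWeight_expectation_le {ι : Type*} [DecidableEq ι] {s : Finset ι} {p : ι → ℝ}
    (hp : ∀ i ∈ s, 0 ≤ p i ∧ p i ≤ 1) {μ : ℝ} (hμ : 1 ≤ μ) (hs : ∑ i ∈ s, p i ≤ μ) {k : ℕ}
    (hk : μ ≤ ((k : ℝ) - μ) ^ 2) (hkμ : μ < k) :
    bernoulliExp s p (fun w => if w + 2 ≤ k then steinWeight μ w else 0)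
      ≤ 5 * (((k : ℝ) - μ) ^ 2 / μ) := by
  have hμ0 : 0 < μ := by linarith
  obtain ⟨d, hd⟩ : ∃ d : ℝ, d = k - μ := ⟨_, rfl⟩
  rw [← hd] at hk ⊢
  have hd1 : 1 ≤ d := by nlinarith
  have hk2 : 2 ≤ k := by
    have : (1 : ℝ) < k := by linarith
    exact_mod_cast this
  have hkd : (k : ℝ) = μ + d := by linarith
  -- With `τ = 2d`, the hypothesis `μ ≤ d²` gives `R = (μ + 2d)/(d + 2) ≤ d`, so `τ²/2 + τR + R² ≤
  -- (2 + 2 + 1) d²`.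
  refine (bernoulliExp.steinWeight_le_of_tilt (τ := 2 * d) hp hμ0 hs (by linarith) hk2
    (by linarith) rfl).trans ?_
  have h1 : μ + 2 * d - (k - 2) = d + 2 := by rw [hkd]; ring
  rw [h1, ← mul_div_assoc 5]
  have hR : (μ + 2 * d) / (d + 2) ≤ d := by
    rw [div_le_iff₀ (by linarith)]; linarith
  have hR0 : 0 ≤ (μ + 2 * d) / (d + 2) := by positivity
  gcongr
  nlinarith

/-! ### The constant `M` and the lower bound. -/

lemma four_le_poissonBinomialM {μ μ₂ : ℝ} (hμ : 1 ≤ μ) (h0 : 0 < μ₂) (h1 : μ₂ < μ) :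
    4 ≤ poissonBinomialM μ μ₂ := by
  rw [poissonBinomialM, if_neg (not_lt.2 hμ)]
  have he : 2 ≤ Real.exp (13 / 12) := by linarith [Real.add_one_le_exp (13 / 12 : ℝ)]
  have hs : 2 ≤ Real.sqrt (2 * Real.pi) :=
    Real.le_sqrt_of_sq_le (by linarith [Real.pi_gt_three])
  have hq : μ₂ / μ < 1 := (div_lt_one (by linarith)).2 h1
  have hq0 : 0 < μ₂ / μ := div_pos h0 (by linarith)
  have hr : 1 ≤ (1 - μ₂ / μ) ^ (-(1 / 2) : ℝ) :=
    Real.one_le_rpow_of_pos_of_le_one_of_nonpos (by linarith) (by linarith) (by norm_num)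
  calc (4 : ℝ) = 2 * 2 * 1 := by norm_num
    _ ≤ _ := by gcongr

lemma one_le_poissonBinomialM_of_lt_one {μ : ℝ} (hμ : 0 ≤ μ) (hμ1 : μ < 1) (μ₂ : ℝ) :
    1 ≤ poissonBinomialM μ μ₂ := by
  rw [poissonBinomialM, if_pos hμ1]
  exact Real.one_le_exp hμ

/-- Relative lower bound for the tail of a sum of independent Bernoulli variables. -/
lemma bernoulliExp_tail_div_ge {ι : Type*} [DecidableEq ι] {s : Finset ι} (hs : s.Nonempty)
    {p : ι → ℝ} (hp : ∀ i ∈ s, 0 < p i ∧ p i < 1) {μ μ₂ : ℝ} (hμ : μ = ∑ i ∈ s, p i)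
    (hμ₂ : μ₂ = ∑ i ∈ s, p i ^ 2) {k : ℕ} {x : ℝ} (hx : x = ((k : ℝ) - μ) / Real.sqrt μ)
    (hx1 : 1 ≤ x) :
    -(2 * poissonBinomialM μ μ₂ * (μ₂ / μ) *
        (x ^ 2 + 1 + 4 * x * Real.sqrt ((1 - Real.exp (-μ)) / μ)))
      < bernoulliExp s p (fun w => if k ≤ w then 1 else 0) / (1 - poissonCdf μ k) - 1 := by
  have hμ0 : 0 < μ := hμ ▸ Finset.sum_pos (fun i hi => (hp i hi).1) hs
  have hμ₂0 : 0 < μ₂ := hμ₂ ▸ Finset.sum_pos (fun i hi => pow_pos (hp i hi).1 2) hs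
  have hμ₂lt : μ₂ < μ := by
    rw [hμ, hμ₂]
    exact Finset.sum_lt_sum_of_nonempty hs fun i hi => by nlinarith [hp i hi]
  have hsq : 0 < Real.sqrt μ := Real.sqrt_pos.2 hμ0
  have hd : Real.sqrt μ ≤ k - μ := by
    rw [hx, le_div_iff₀ hsq] at hx1; linarith
  have hx2 : x ^ 2 = ((k : ℝ) - μ) ^ 2 / μ := by rw [hx, div_pow, Real.sq_sqrt hμ0.le]
  have hdsq : μ ≤ ((k : ℝ) - μ) ^ 2 := by
    calc μ = Real.sqrt μ ^ 2 := (Real.sq_sqrt hμ0.le).symm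
      _ ≤ _ := by gcongr
  have hkμ : μ < k := by linarith
  have hk1 : 1 ≤ k := by
    have : (0 : ℝ) < k := by linarith
    exact_mod_cast this
  have hp' : ∀ i ∈ s, 0 ≤ p i ∧ p i ≤ 1 := fun i hi => ⟨(hp i hi).1.le, (hp i hi).2.le⟩
  set M := poissonBinomialM μ μ₂ with hM
  set y := x ^ 2 + 1 + 4 * x * Real.sqrt ((1 - Real.exp (-μ)) / μ) with hy
  have hyx : x ^ 2 + 1 ≤ y := by
    have := Real.sqrt_nonneg ((1 - Real.exp (-μ)) / μ)
    have : 0 ≤ 4 * x * Real.sqrt ((1 - Real.exp (-μ)) / μ) := by positivity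
    linarith
  have hT : 0 < 1 - poissonCdf μ k := sub_pos.2 (poissonCdf_lt_one hμ0 k)
  have hbound : ∀ i ∈ s, bernoulliExp (s.erase i) p
      (fun w => if w + 2 ≤ k then steinWeight μ w else 0) < 2 * M * y := by
    intro i hi
    have hpe : ∀ j ∈ s.erase i, 0 ≤ p j ∧ p j ≤ 1 := fun j hj => hp' j (Finset.mem_of_mem_erase hj)
    have hse : ∑ j ∈ s.erase i, p j ≤ μ := by
      rw [hμ]
      exact Finset.sum_le_sum_of_subset_of_nonneg (Finset.erase_subset i s)
        fun j hj _ => (hp' j hj).1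
    -- The bounds `2x²` and `5x²` are compared with `2M(x² + 1)`, where `M ≥ 1` and `M ≥ 4`
    -- respectively.
    rcases lt_or_ge μ 1 with h1 | h1
    · have hM1 : 1 ≤ M := one_le_poissonBinomialM_of_lt_one hμ0.le h1 μ₂
      have := steinWeight_expectation_le_of_lt_one hpe hμ0 h1 hse hk1
      rw [← hx2] at this
      nlinarith
    · have hM4 : 4 ≤ M := four_le_poissonBinomialM h1 hμ₂0 hμ₂lt
      have := steinWeight_expectation_le hpe h1 hse hdsq hkμ
      rw [← hx2] at this
      nlinarith
  have hsum : ∑ i ∈ s, p i ^ 2 * bernoulliExp (s.erase i) p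
      (fun w => if w + 2 ≤ k then steinWeight μ w else 0) < μ₂ * (2 * M * y) := by
    rw [hμ₂, Finset.sum_mul]
    exact Finset.sum_lt_sum_of_nonempty hs fun i hi =>
      mul_lt_mul_of_pos_left (hbound i hi) (pow_pos (hp i hi).1 2)
  have hmain := bernoulliExp_tail_ge hp' (hμ ▸ hμ0) hk1
  rw [← hμ, mul_comm, ← le_div_iff₀ hT] at hmain
  have hfin : μ⁻¹ * ∑ i ∈ s, p i ^ 2 * bernoulliExp (s.erase i) p
      (fun w => if w + 2 ≤ k then steinWeight μ w else 0) < 2 * M * (μ₂ / μ) * y := by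
    calc _ < μ⁻¹ * (μ₂ * (2 * M * y)) := mul_lt_mul_of_pos_left hsum (inv_pos.2 hμ0)
      _ = _ := by ring
  linarith

/-! ### Convolutions of binomial and Poisson weights. -/

/-- The sequence `0, u 0, u 1, …`. -/
def shiftSeq (u : ℕ → ℝ) : ℕ → ℝ
  | 0 => 0
  | n + 1 => u n

/-- Convolution of the weights `u` with the Bernoulli distribution of parameter `a`. -/
def bernConv (a : ℝ) (u : ℕ → ℝ) (n : ℕ) : ℝ := (1 - a) * u n + a * shiftSeq u n

/-- Weights of the convolution of `Bin(m, a)` and `Pn(θ)`. -/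
noncomputable def binPoisson (m : ℕ) (a θ : ℝ) : ℕ → ℝ := (bernConv a)^[m] (poissonWeight θ)

@[simp] lemma shiftSeq_zero (u : ℕ → ℝ) : shiftSeq u 0 = 0 := rfl

@[simp] lemma shiftSeq_succ (u : ℕ → ℝ) (n : ℕ) : shiftSeq u (n + 1) = u n := rfl

lemma binPoisson_zero (a θ : ℝ) : binPoisson 0 a θ = poissonWeight θ := rfl

lemma binPoisson_succ (m : ℕ) (a θ : ℝ) (n : ℕ) :
    binPoisson (m + 1) a θ n
      = (1 - a) * binPoisson m a θ n + a * shiftSeq (binPoisson m a θ) n := by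
  rw [binPoisson, Function.iterate_succ_apply']
  rfl

lemma binPoisson_prob_zero (m : ℕ) (θ : ℝ) : binPoisson m 0 θ = poissonWeight θ := by
  induction m with
  | zero => rfl
  | succ m ih => ext n; rw [binPoisson_succ, ih]; ring

lemma natCast_mul_poissonWeight (θ : ℝ) (n : ℕ) :
    n * poissonWeight θ n = θ * shiftSeq (poissonWeight θ) n := by
  rcases n with _ | n
  · simp
  · rw [shiftSeq_succ, ← succ_mul_poissonWeight_succ]; push_cast; ring

lemma binPoisson_size_bias (m : ℕ) (a θ : ℝ) (n : ℕ) :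
    (n + 1) * binPoisson (m + 1) a θ (n + 1)
      = θ * binPoisson (m + 1) a θ n + (m + 1) * a * binPoisson m a θ n := by
  induction m generalizing n with
  | zero =>
    rw [binPoisson_succ, binPoisson_succ, shiftSeq_succ, binPoisson_zero]
    have h1 := succ_mul_poissonWeight_succ θ n
    have h2 := natCast_mul_poissonWeight θ n
    push_cast
    linear_combination (1 - a) * h1 + a * h2
  | succ m ih =>
    have h1 := ih n
    have h2 : (n : ℝ) * binPoisson (m + 1) a θ n
        = θ * shiftSeq (binPoisson (m + 1) a θ) n
          + (m + 1) * a * shiftSeq (binPoisson m a θ) n := by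
      rcases n with _ | n
      · simp
      · simpa using ih n
    have h3 := binPoisson_succ m a θ n
    rw [binPoisson_succ (m + 1), binPoisson_succ (m + 1), shiftSeq_succ]
    push_cast
    linear_combination (1 - a) * h1 + a * h2 - (m + 1) * a * h3

/-- Expanding `m + 1` trials into `m` in the size-bias relation leaves a three-term recurrence in a
single sequence. -/
lemma binPoisson_recurrence (m : ℕ) (a θ : ℝ) (n : ℕ) :
    (1 - a) * (n + 1) * binPoisson m a θ (n + 1) + a * n * binPoisson m a θ n
      = (θ * (1 - a) + m * a) * binPoisson m a θ n
        + θ * a * shiftSeq (binPoisson m a θ) n := by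
  have h := binPoisson_size_bias m a θ n
  rw [binPoisson_succ, binPoisson_succ, shiftSeq_succ] at h
  linear_combination h

/-- Strict log-concavity holds for Poisson weights and survives convolution with a Bernoulli law. -/
lemma binPoisson_logConcave (m : ℕ) {a θ : ℝ} (ha : 0 ≤ a) (ha1 : a < 1) (hθ : 0 < θ) :
    (∀ n, 0 < binPoisson m a θ n) ∧ ∀ n, binPoisson m a θ n * binPoisson m a θ (n + 2)
      < binPoisson m a θ (n + 1) ^ 2 := by
  induction m with
  | zero =>
    refine ⟨poissonWeight_pos hθ, fun n => ?_⟩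
    rw [binPoisson_zero]
    have h0 := poissonWeight_pos hθ n
    have h1 := succ_mul_poissonWeight_succ θ n
    have h2 := succ_mul_poissonWeight_succ θ (n + 1)
    have p1 := poissonWeight_pos hθ (n + 1)
    have p2 := poissonWeight_pos hθ (n + 2)
    push_cast at h2
    have h3 : ((n : ℝ) + 1) * poissonWeight θ (n + 1) ^ 2
        = (n + 2) * (poissonWeight θ n * poissonWeight θ (n + 2)) := by
      linear_combination poissonWeight θ (n + 1) * h1 - poissonWeight θ n * h2
    nlinarith [mul_pos h0 p2, (Nat.cast_nonneg n : (0 : ℝ) ≤ n)]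
  | succ m ih =>
    obtain ⟨hpos, hlc⟩ := ih
    have hb : 0 < 1 - a := by linarith
    refine ⟨fun n => ?_, fun n => ?_⟩
    · rw [binPoisson_succ]
      refine add_pos_of_pos_of_nonneg (mul_pos hb (hpos n)) (mul_nonneg ha ?_)
      rcases n with _ | n
      · exact le_rfl
      · exact (hpos n).le
    · rw [binPoisson_succ, binPoisson_succ, binPoisson_succ]
      simp only [shiftSeq_succ]
      rcases n with _ | n
      · rw [shiftSeq_zero]
        have h0 := hpos 0
        have h1 := hpos 1
        have l0 := hlc 0
        simp only [zero_add] at l0 ⊢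
        nlinarith [mul_pos (pow_pos hb 2) (sub_pos.2 l0),
          mul_nonneg (mul_nonneg ha hb.le) (mul_pos h0 h1).le, sq_nonneg (a * binPoisson m a θ 0)]
      · rw [shiftSeq_succ]
        have l0 := hlc n
        have l1 := hlc (n + 1)
        have p0 := hpos n
        have p1 := hpos (n + 1)
        have p2 := hpos (n + 1 + 1)
        have p3 := hpos (n + 1 + 2)
        -- The cross term of the convolution: multiply two consecutive log-concavity inequalities
        -- and cancel.
        have hcross : binPoisson m a θ n * binPoisson m a θ (n + 1 + 2)
            ≤ binPoisson m a θ (n + 1) * binPoisson m a θ (n + 1 + 1) := by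
          have h := mul_lt_mul'' l0 l1 (by positivity) (by positivity)
          refine le_of_mul_le_mul_right (a := binPoisson m a θ (n + 1)
            * binPoisson m a θ (n + 1 + 1)) ?_ (mul_pos p1 p2)
          calc _ = binPoisson m a θ n * binPoisson m a θ (n + 2)
                * (binPoisson m a θ (n + 1) * binPoisson m a θ (n + 1 + 2)) := by ring
            _ ≤ _ := h.le
            _ = _ := by ring
        nlinarith [mul_pos (pow_pos hb 2) (sub_pos.2 l1),
          mul_nonneg (mul_nonneg ha hb.le) (sub_nonneg.2 hcross),
          mul_nonneg (sq_nonneg a) (sub_pos.2 l0).le]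

/-- If the weights did not drop from `n` to `n + 1`, log-concavity would make them increase strictly
from `n - 1` to `n`; the recurrence would then force `n + 1 < θ + (m+1) a`. -/
lemma binPoisson_succ_lt {m n : ℕ} {a θ : ℝ} (ha : 0 < a) (ha1 : a < 1) (hθ : 0 < θ)
    (hmean : θ + (m + 1) * a ≤ n + 1) : binPoisson m a θ (n + 1) < binPoisson m a θ n := by
  obtain ⟨hpos, hlc⟩ := binPoisson_logConcave m ha.le ha1 hθ
  by_contra! hle
  have hshift : shiftSeq (binPoisson m a θ) n < binPoisson m a θ n := by
    rcases n with _ | n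
    · exact hpos 0
    · have h1 := hlc n
      rw [shiftSeq_succ]
      have p0 := hpos n
      have p1 := hpos (n + 1)
      by_contra! h2
      have : binPoisson m a θ (n + 1) * binPoisson m a θ (n + 1)
          ≤ binPoisson m a θ n * binPoisson m a θ (n + 2) :=
        mul_le_mul h2 hle p1.le p0.le
      nlinarith
  have hrec := binPoisson_recurrence m a θ n
  have hp := hpos n
  have h1 : (1 - a) * (n + 1) * binPoisson m a θ n ≤ (1 - a) * (n + 1) * binPoisson m a θ (n + 1) :=
    mul_le_mul_of_nonneg_left hle (mul_nonneg (by linarith) (by positivity))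
  have h2 := mul_lt_mul_of_pos_left hshift (mul_pos hθ ha)
  have h3 : ((n : ℝ) + 1) * binPoisson m a θ n < (θ + (m + 1) * a) * binPoisson m a θ n := by
    linarith
  exact absurd (lt_of_mul_lt_mul_right h3 hp.le) (not_lt.2 hmean)

/-! ### Interpolation from binomial to Poisson at constant mean. -/

lemma hasDerivAt_poissonWeight (θ : ℝ) (n : ℕ) :
    HasDerivAt (fun θ => poissonWeight θ n)
      (shiftSeq (poissonWeight θ) n - poissonWeight θ n) θ := by
  unfold poissonWeight
  have h := (((hasDerivAt_id θ).neg.exp.mul (hasDerivAt_pow n θ))).div_const (n.factorial : ℝ)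
  refine h.congr_deriv ?_
  rcases n with _ | n
  · simp
  · rw [shiftSeq_succ, Nat.factorial_succ]
    push_cast
    simp only [Pi.neg_apply, id]
    field_simp
    ring

/-- This differentiates the generating function `(1 + a(z-1))^m exp(θ(z-1))` along the path. The
speed `M` is independent of `m` so that induction on `m` applies; at `m = 0` the truncated `m - 1`
has coefficient `0`. -/
lemma hasDerivAt_binPoisson_path (m : ℕ) (M a θ ε : ℝ) (n : ℕ) :
    HasDerivAt (fun ε => binPoisson m (a - ε) (θ + M * ε) n)
      (M * (shiftSeq (binPoisson m (a - ε) (θ + M * ε)) n - binPoisson m (a - ε) (θ + M * ε) n)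
        - m * (shiftSeq (binPoisson (m - 1) (a - ε) (θ + M * ε)) n
          - binPoisson (m - 1) (a - ε) (θ + M * ε) n)) ε := by
  induction m generalizing n with
  | zero =>
    have h1 : HasDerivAt (fun ε : ℝ => θ + M * ε) (M * 1) ε :=
      ((hasDerivAt_id ε).const_mul M).const_add θ
    have h := (hasDerivAt_poissonWeight (θ + M * ε) n).comp ε h1
    refine h.congr_deriv ?_
    simp only [binPoisson_zero]
    push_cast
    ring
  | succ m ih =>
    have ha : HasDerivAt (fun ε : ℝ => a - ε) (-1) ε := (hasDerivAt_id ε).const_sub a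
    have hs : HasDerivAt (fun ε => shiftSeq (binPoisson m (a - ε) (θ + M * ε)) n)
        (shiftSeq (fun n => M * (shiftSeq (binPoisson m (a - ε) (θ + M * ε)) n
          - binPoisson m (a - ε) (θ + M * ε) n)
        - m * (shiftSeq (binPoisson (m - 1) (a - ε) (θ + M * ε)) n
          - binPoisson (m - 1) (a - ε) (θ + M * ε) n)) n) ε := by
      rcases n with _ | n
      · exact hasDerivAt_const _ _
      · exact ih n
    simp only [binPoisson_succ]
    refine (((ha.const_sub 1).mul (ih n)).add (ha.mul hs)).congr_deriv ?_
    rw [Nat.add_sub_cancel]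
    push_cast
    rcases m with _ | m
    · rcases n with _ | n
      · simp; ring
      · simp [binPoisson_succ]; ring
    · simp only [Nat.add_sub_cancel]
      rcases n with _ | n
      · simp only [shiftSeq_zero, binPoisson_succ]; push_cast; ring
      · simp only [shiftSeq_succ]
        have h1 := binPoisson_succ m (a - ε) (θ + M * ε) n
        have h2 := binPoisson_succ m (a - ε) (θ + M * ε) (n + 1)
        rw [shiftSeq_succ] at h2
        have h3 := binPoisson_succ (m + 1) (a - ε) (θ + M * ε) n
        push_cast
        linear_combination (m + 1) * h1 - (m + 1) * h2 - M * h3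

lemma sum_range_shiftSeq_sub (u : ℕ → ℝ) (k : ℕ) :
    ∑ n ∈ Finset.range (k + 1), (shiftSeq u n - u n) = -u k := by
  induction k with
  | zero => simp
  | succ k ih => rw [Finset.sum_range_succ, ih, shiftSeq_succ]; ring

/-- The distribution function (at `k - 1`) of the convolution of `Bin(m, a)` and `Pn(θ)`. -/
noncomputable def binPoissonCdf (m : ℕ) (a θ : ℝ) (k : ℕ) : ℝ :=
  ∑ n ∈ Finset.range k, binPoisson m a θ n

/-- The speed `m + 1` keeps the mean constant. The sums telescope, and unfolding one trial combines
the two boundary weights. -/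
lemma hasDerivAt_binPoissonCdf_path (m : ℕ) (a θ ε : ℝ) (k : ℕ) :
    HasDerivAt (fun ε => binPoissonCdf (m + 1) (a - ε) (θ + (m + 1) * ε) (k + 2))
      ((m + 1) * (a - ε) * (binPoisson m (a - ε) (θ + (m + 1) * ε) (k + 1)
        - binPoisson m (a - ε) (θ + (m + 1) * ε) k)) ε := by
  unfold binPoissonCdf
  have h := HasDerivAt.fun_sum fun n (_ : n ∈ Finset.range (k + 2)) =>
    hasDerivAt_binPoisson_path (m + 1) (m + 1) a θ ε n
  refine h.congr_deriv ?_
  rw [Nat.add_sub_cancel]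
  push_cast
  rw [Finset.sum_sub_distrib, ← Finset.mul_sum, ← Finset.mul_sum, sum_range_shiftSeq_sub,
    sum_range_shiftSeq_sub, binPoisson_succ, shiftSeq_succ]
  ring

/-- Replacing a binomial component by a Poisson one of the same mean makes the right tail
heavier, at points at least one above the total mean. -/
lemma poissonCdf_lt_binPoissonCdf {m k : ℕ} {a θ : ℝ} (ha : 0 < a) (ha1 : a ≤ 1) (hθ : 0 ≤ θ)
    (hmean : θ + (m + 1) * a ≤ k + 1) :
    poissonCdf (θ + (m + 1) * a) (k + 2) < binPoissonCdf (m + 1) a θ (k + 2) := by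
  have hanti : StrictAntiOn
      (fun ε => binPoissonCdf (m + 1) (a - ε) (θ + (m + 1) * ε) (k + 2)) (Set.Icc 0 a) := by
    -- Only interior `ε` matter: there the Poisson parameter is positive and `a - ε < 1`, even when
    -- `θ = 0` or `a = 1`.
    refine strictAntiOn_of_deriv_neg (convex_Icc 0 a) (fun ε _ =>
      (hasDerivAt_binPoissonCdf_path m a θ ε k).continuousAt.continuousWithinAt) fun ε hε => ?_
    rw [interior_Icc] at hε
    rw [(hasDerivAt_binPoissonCdf_path m a θ ε k).deriv]
    have hlt := binPoisson_succ_lt (m := m) (n := k) (a := a - ε) (θ := θ + (m + 1) * ε)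
      (by linarith [hε.2]) (by linarith [hε.1])
      (add_pos_of_nonneg_of_pos hθ (mul_pos (by positivity) hε.1)) (by linarith)
    exact mul_neg_of_pos_of_neg (mul_pos (by positivity) (by linarith [hε.2])) (by linarith)
  have h := hanti (Set.left_mem_Icc.2 ha.le) (Set.right_mem_Icc.2 ha.le) ha
  simp only [sub_self, sub_zero, mul_zero, add_zero] at h
  simpa only [binPoissonCdf, binPoisson_prob_zero, poissonCdf] using h

lemma sum_range_shiftSeq (u : ℕ → ℝ) (k : ℕ) :
    ∑ n ∈ Finset.range k, shiftSeq u n = shiftSeq (fun k => ∑ n ∈ Finset.range k, u n) k := by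
  rcases k with _ | k
  · rfl
  · rw [Finset.sum_range_succ', shiftSeq_succ]; simp

lemma binPoissonCdf_succ (m : ℕ) (a θ : ℝ) (k : ℕ) :
    binPoissonCdf (m + 1) a θ k
      = (1 - a) * binPoissonCdf m a θ k + a * shiftSeq (binPoissonCdf m a θ) k := by
  simp only [binPoissonCdf, binPoisson_succ, Finset.sum_add_distrib, ← Finset.mul_sum,
    sum_range_shiftSeq]
  rfl

lemma binPoissonCdf_zero_zero (a : ℝ) (k : ℕ) :
    binPoissonCdf 0 a 0 k = if 0 < k then 1 else 0 := by
  rcases k with _ | k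
  · simp [binPoissonCdf]
  · simp [binPoissonCdf, binPoisson_zero, Finset.sum_range_succ', poissonWeight]

/-- `Bin(r, 1)` is the constant `r`, so the sure successes are handled by the same interpolation
with `a = 1`. -/
lemma binPoissonCdf_one_add (r : ℕ) (θ : ℝ) (k : ℕ) :
    binPoissonCdf r 1 θ (k + r) = poissonCdf θ k := by
  induction r with
  | zero => rfl
  | succ r ih => rw [binPoissonCdf_succ, ← add_assoc, shiftSeq_succ, ih]; ring

/-! ### Hoeffding's reduction to equal probabilities. -/

namespace bernoulliExp

variable {ι : Type*} [DecidableEq ι] {s t : Finset ι} {p : ι → ℝ}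

lemma cdf_insert {a : ι} (ha : a ∉ s) (p : ι → ℝ) (k : ℕ) :
    bernoulliExp (Insert.insert a s) p (fun w => if w < k then 1 else 0)
      = (1 - p a) * bernoulliExp s p (fun w => if w < k then 1 else 0)
        + p a * shiftSeq (fun k => bernoulliExp s p (fun w => if w < k then 1 else 0)) k := by
  rw [insert ha]
  rcases k with _ | k
  · simp [const]
  · simp

lemma cdf_eq_binPoissonCdf {a : ℝ} (h : ∀ i ∈ s, p i = a) (k : ℕ) :
    bernoulliExp s p (fun w => if w < k then 1 else 0) = binPoissonCdf s.card a 0 k := by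
  induction s using Finset.induction_on generalizing k with
  | empty => rw [empty, Finset.card_empty, binPoissonCdf_zero_zero]
  | insert b s hb ih =>
    have ih' := fun k => ih (fun i hi => h i (Finset.mem_insert_of_mem hi)) k
    rw [cdf_insert hb, Finset.card_insert_of_notMem hb, binPoissonCdf_succ,
      h b (Finset.mem_insert_self b s)]
    simp only [ih']

lemma cdf_union_one (hst : Disjoint s t) (h : ∀ i ∈ t, p i = 1) (k : ℕ) :
    bernoulliExp (s ∪ t) p (fun w => if w < k + t.card then 1 else 0)
      = bernoulliExp s p (fun w => if w < k then 1 else 0) := by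
  induction t using Finset.induction_on with
  | empty => simp
  | insert b t hb ih =>
    rw [Finset.disjoint_insert_right] at hst
    rw [Finset.union_insert, cdf_insert (by simp [hb, hst.1]), Finset.card_insert_of_notMem hb,
      ← add_assoc, shiftSeq_succ, h b (Finset.mem_insert_self b t),
      ih hst.2 fun i hi => h i (Finset.mem_insert_of_mem hi)]
    ring

lemma union_zero (hst : Disjoint s t) (h : ∀ i ∈ t, p i = 0) (g : ℕ → ℝ) :
    bernoulliExp (s ∪ t) p g = bernoulliExp s p g := by
  induction t using Finset.induction_on with
  | empty => simp
  | insert b t hb ih =>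
    rw [Finset.disjoint_insert_right] at hst
    rw [Finset.union_insert, insert (by simp [hb, hst.1]), h b (Finset.mem_insert_self b t),
      ih hst.2 fun i hi => h i (Finset.mem_insert_of_mem hi)]
    ring

lemma pair {i j : ι} (hij : i ≠ j) (hi : i ∈ s) (hj : j ∈ s) (p : ι → ℝ) (h : ℕ → ℝ) :
    bernoulliExp s p h
      = (1 - p i) * ((1 - p j) * bernoulliExp ((s.erase i).erase j) p h
          + p j * bernoulliExp ((s.erase i).erase j) p (fun w => h (w + 1)))
        + p i * ((1 - p j) * bernoulliExp ((s.erase i).erase j) p (fun w => h (w + 1))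
          + p j * bernoulliExp ((s.erase i).erase j) p (fun w => h (w + 1 + 1))) := by
  have hj' : j ∈ s.erase i := Finset.mem_erase.2 ⟨hij.symm, hj⟩
  rw [erase hi, erase hj' p h, erase hj' p fun w => h (w + 1)]

/-- Moving mass between two success probabilities changes an expectation by a multiple of the
change of their product. -/
lemma exists_transfer {i j : ι} (hij : i ≠ j) (hi : i ∈ s) (hj : j ∈ s) (p : ι → ℝ)
    (h : ℕ → ℝ) : ∃ C : ℝ, ∀ t : ℝ,
      bernoulliExp s (p + Pi.single i t - Pi.single j t) h
        = bernoulliExp s p h + C * (t * (p j - p i) - t ^ 2) := by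
  -- `C` is the expected second difference of `h` at the sum of the other variables.
  refine ⟨bernoulliExp ((s.erase i).erase j) p h
    - 2 * bernoulliExp ((s.erase i).erase j) p (fun w => h (w + 1))
    + bernoulliExp ((s.erase i).erase j) p (fun w => h (w + 1 + 1)), fun t => ?_⟩
  have hc : ∀ g : ℕ → ℝ, bernoulliExp ((s.erase i).erase j) (p + Pi.single i t - Pi.single j t) g
      = bernoulliExp ((s.erase i).erase j) p g := by
    intro g
    refine congr_prob g fun l hl => ?_
    have hlj : l ≠ j := Finset.ne_of_mem_erase hl
    have hli : l ≠ i := Finset.ne_of_mem_erase (Finset.mem_of_mem_erase hl)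
    simp [Pi.single_eq_of_ne hlj, Pi.single_eq_of_ne hli]
  rw [pair hij hi hj, pair hij hi hj p, hc, hc, hc]
  simp only [Pi.add_apply, Pi.sub_apply, Pi.single_eq_same, Pi.single_eq_of_ne hij,
    Pi.single_eq_of_ne hij.symm]
  ring

end bernoulliExp

/-- Hoeffding's reduction: for a given mean, the expectation of `h` is minimal at some
probabilities all of whose values in `(0, 1)` are equal. -/
lemma exists_minimal_equal_probs {ι : Type*} [Fintype ι] [DecidableEq ι] (h : ℕ → ℝ)
    {p : ι → ℝ} (hp : ∀ i, 0 ≤ p i ∧ p i ≤ 1) :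
    ∃ q : ι → ℝ, (∀ i, 0 ≤ q i ∧ q i ≤ 1) ∧ ∑ i, q i = ∑ i, p i ∧
      bernoulliExp Finset.univ q h ≤ bernoulliExp Finset.univ p h ∧
      ∀ i j, 0 < q i → q i < 1 → 0 < q j → q j < 1 → q i = q j := by
  let K : Set (ι → ℝ) := Set.Icc 0 1 ∩ {q | ∑ i, q i = ∑ i, p i}
  have hKmem : ∀ q : ι → ℝ, q ∈ K ↔ (∀ i, 0 ≤ q i ∧ q i ≤ 1) ∧ ∑ i, q i = ∑ i, p i := by
    intro q
    refine and_congr ⟨fun hq i => ⟨hq.1 i, hq.2 i⟩, fun hq => ⟨fun i => (hq i).1, fun i =>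
      (hq i).2⟩⟩ Iff.rfl
  have hK : IsCompact K := isCompact_Icc.inter_right
    (isClosed_eq (by fun_prop) continuous_const)
  have hf := bernoulliExp.continuous (Finset.univ : Finset ι) h
  obtain ⟨q₀, hq₀K, hq₀⟩ := hK.exists_isMinOn ⟨p, (hKmem p).2 ⟨hp, rfl⟩⟩ hf.continuousOn
  have hK' : IsCompact (K ∩ {q | bernoulliExp Finset.univ q h
      = bernoulliExp Finset.univ q₀ h}) := hK.inter_right (isClosed_eq hf continuous_const)
  -- Among the minimizers, one with least `∑ qᵢ²` is selected, to break ties.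
  obtain ⟨q, ⟨hqK, hqf⟩, hq⟩ := hK'.exists_isMinOn (f := fun q : ι → ℝ => ∑ i, q i ^ 2)
    ⟨q₀, hq₀K, rfl⟩ (by fun_prop)
  have hqf' : bernoulliExp Finset.univ q h = bernoulliExp Finset.univ q₀ h := hqf
  obtain ⟨hq01, hqs⟩ := (hKmem q).1 hqK
  have hmin : ∀ r ∈ K, bernoulliExp Finset.univ q h ≤ bernoulliExp Finset.univ r h :=
    fun r hr => hqf'.le.trans (hq₀ hr)
  have key : ∀ i j, 0 < q i → q j < 1 → ¬ q i < q j := by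
    intro i j hi0 hj1 hlt
    have hij : i ≠ j := fun h => by simp [h] at hlt
    obtain ⟨C, hC⟩ := bernoulliExp.exists_transfer hij (Finset.mem_univ i) (Finset.mem_univ j) q h
    have hval : ∀ (t : ℝ) (l : ι), (q + Pi.single i t - Pi.single j t : ι → ℝ) l
        = if l = i then q i + t else if l = j then q j - t else q l := by
      intro t l
      by_cases hli : l = i
      · subst hli; simp [hij]
      · by_cases hlj : l = j
        · subst hlj; simp [hij.symm]
        · simp [hli, hlj]
    have hmem : ∀ t, 0 ≤ q i + t → q i + t ≤ 1 → 0 ≤ q j - t → q j - t ≤ 1 →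
        q + Pi.single i t - Pi.single j t ∈ K := by
      intro t h1 h2 h3 h4
      refine (hKmem _).2 ⟨fun l => ?_, ?_⟩
      · rw [hval]
        split_ifs
        exacts [⟨h1, h2⟩, ⟨h3, h4⟩, hq01 l]
      · rw [← hqs]
        simp [Finset.sum_add_distrib]
    obtain ⟨δ, hδ⟩ : ∃ δ, δ = q j - q i := ⟨_, rfl⟩
    have hδ0 : 0 < δ := by linarith
    have hmid := hmem (δ / 2) (by linarith) (by linarith) (by linarith) (by linarith)
    -- Averaging `q i` and `q j` gives `C ≥ 0`; spreading them apart gives `C ≤ 0`. With `C = 0`,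
    -- averaging preserves the minimum but lowers the sum of squares.
    have hC0 : 0 ≤ C := by
      have h1 := hmin _ hmid
      rw [hC, ← hδ] at h1
      have h2 : 0 < δ / 2 * δ - (δ / 2) ^ 2 := by nlinarith
      by_contra! h3
      nlinarith [mul_neg_of_neg_of_pos h3 h2]
    have hC1 : C ≤ 0 := by
      obtain ⟨η, hη0, hη1, hη2⟩ : ∃ η, 0 < η ∧ η ≤ q i ∧ η ≤ 1 - q j :=
        ⟨min (q i) (1 - q j), lt_min hi0 (by linarith), min_le_left _ _, min_le_right _ _⟩
      have h1 := hmin _ (hmem (-η) (by linarith) (by linarith) (by linarith) (by linarith))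
      rw [hC, ← hδ] at h1
      have h2 : -η * δ - (-η) ^ 2 < 0 := by nlinarith [mul_pos hη0 hδ0]
      by_contra! h3
      nlinarith [mul_neg_of_pos_of_neg h3 h2]
    have hC2 : C = 0 := le_antisymm hC1 hC0
    have hsq : ∑ l, q l ^ 2 ≤ ∑ l, (q + Pi.single i (δ / 2) - Pi.single j (δ / 2) : ι → ℝ) l ^ 2 :=
      hq ⟨hmid, by
        change bernoulliExp Finset.univ _ h = _
        rw [hC, hC2, zero_mul, add_zero, hqf']⟩
    have hji : j ∈ Finset.univ.erase i := by simp [hij.symm]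
    simp only [hval] at hsq
    rw [← Finset.add_sum_erase _ _ (Finset.mem_univ i), ← Finset.add_sum_erase _ _ hji,
      ← Finset.add_sum_erase _ _ (Finset.mem_univ i), ← Finset.add_sum_erase _ _ hji,
      if_pos rfl, if_neg hij.symm, if_pos rfl] at hsq
    have hrest : ∑ l ∈ (Finset.univ.erase i).erase j,
        (if l = i then q i + δ / 2 else if l = j then q j - δ / 2 else q l) ^ 2
        = ∑ l ∈ (Finset.univ.erase i).erase j, q l ^ 2 := by
      refine Finset.sum_congr rfl fun l hl => ?_
      rw [if_neg (Finset.ne_of_mem_erase (Finset.mem_of_mem_erase hl)),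
        if_neg (Finset.ne_of_mem_erase hl)]
    rw [hrest] at hsq
    nlinarith
  refine ⟨q, hq01, hqs, hmin p ((hKmem p).2 ⟨hp, rfl⟩), fun i j hi0 hi1 hj0 hj1 => ?_⟩
  exact le_antisymm (not_lt.1 (key j i hj0 hi1)) (not_lt.1 (key i j hi0 hj1))

/-- At points at least one above the mean, the right tail of a sum of independent Bernoulli
variables is lighter than that of the Poisson distribution. -/
lemma poissonCdf_lt_bernoulliExp {ι : Type*} [Fintype ι] [DecidableEq ι] {p : ι → ℝ}
    (hp : ∀ i, 0 ≤ p i ∧ p i ≤ 1) (hpos : 0 < ∑ i, p i) {k : ℕ} (hk : ∑ i, p i + 1 ≤ k) :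
    poissonCdf (∑ i, p i) k < bernoulliExp Finset.univ p (fun w => if w < k then 1 else 0) := by
  obtain ⟨q, hq01, hqs, hle, heq⟩ :=
    exists_minimal_equal_probs (fun w => if w < k then 1 else 0) hp
  refine lt_of_lt_of_le ?_ hle
  rw [← hqs] at hpos hk ⊢
  let A := Finset.univ.filter fun i => 0 < q i ∧ q i < 1
  let O := Finset.univ.filter fun i => q i = 1
  let Z := Finset.univ.filter fun i => q i = 0
  obtain ⟨a, ha0, ha1, ha⟩ : ∃ a : ℝ, 0 < a ∧ a ≤ 1 ∧ ∀ i ∈ A, q i = a := by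
    rcases A.eq_empty_or_nonempty with hA | ⟨j, hj⟩
    · exact ⟨1, one_pos, le_rfl, by simp [hA]⟩
    · have hj' := (Finset.mem_filter.1 hj).2
      refine ⟨q j, hj'.1, hj'.2.le, fun i hi => ?_⟩
      have hi' := (Finset.mem_filter.1 hi).2
      exact heq i j hi'.1 hi'.2 hj'.1 hj'.2
  have hO : ∀ i ∈ O, q i = 1 := fun i hi => (Finset.mem_filter.1 hi).2
  have hZ : ∀ i ∈ Z, q i = 0 := fun i hi => (Finset.mem_filter.1 hi).2
  have hAO : Disjoint A O := Finset.disjoint_filter.2 fun i _ h1 h2 => by linarith [h1.2]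
  have hAOZ : Disjoint (A ∪ O) Z := by
    refine Finset.disjoint_left.2 fun i hi hiZ => ?_
    have hz := hZ i hiZ
    rcases Finset.mem_union.1 hi with h | h
    · linarith [(Finset.mem_filter.1 h).2.1]
    · linarith [hO i h]
  have huniv : (Finset.univ : Finset ι) = (A ∪ O) ∪ Z := by
    ext i
    simp only [A, O, Z, Finset.mem_univ, Finset.mem_union, Finset.mem_filter, true_and, true_iff]
    rcases (hq01 i).1.lt_or_eq with h0 | h0
    · rcases (hq01 i).2.lt_or_eq with h1 | h1
      · exact Or.inl (Or.inl ⟨h0, h1⟩)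
      · exact Or.inl (Or.inr h1)
    · exact Or.inr h0.symm
  have hsum : ∑ i, q i = A.card * a + O.card := by
    rw [huniv, Finset.sum_union hAOZ, Finset.sum_union hAO, Finset.sum_congr rfl ha,
      Finset.sum_congr rfl hO, Finset.sum_congr rfl hZ]
    simp
  rw [hsum] at hpos hk ⊢
  rw [huniv, bernoulliExp.union_zero hAOZ hZ]
  have hAa : 0 ≤ (A.card : ℝ) * a := mul_nonneg (Nat.cast_nonneg _) ha0.le
  have hOk : O.card ≤ k := by
    have : (O.card : ℝ) ≤ k := by linarith
    exact_mod_cast this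
  obtain ⟨l, rfl⟩ := Nat.exists_eq_add_of_le' hOk
  rw [bernoulliExp.cdf_union_one hAO hO, bernoulliExp.cdf_eq_binPoissonCdf ha]
  generalize A.card = m at *
  generalize O.card = r at *
  push_cast at hk
  -- First the `Bin(m, a)` part becomes `Pn(ma)`, then the constant `r` becomes `Pn(r)`. One
  -- replacement is strict because the mean is positive.
  have hstep1 : poissonCdf (m * a) l ≤ binPoissonCdf m a 0 l ∧
      (0 < m → poissonCdf (m * a) l < binPoissonCdf m a 0 l) := by
    rcases m with _ | m
    · refine ⟨le_of_eq ?_, fun h => absurd h (lt_irrefl _)⟩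
      rw [Nat.cast_zero, zero_mul]
      rfl
    · have hma : 0 < ((m + 1 : ℕ) : ℝ) * a := by positivity
      have hl : 2 ≤ l := by
        have : (1 : ℝ) < l := by linarith
        exact_mod_cast this
      obtain ⟨n, rfl⟩ := Nat.exists_eq_add_of_le' hl
      have := poissonCdf_lt_binPoissonCdf (m := m) (k := n) ha0 ha1 le_rfl
        (by push_cast at hk; linarith)
      rw [zero_add] at this
      push_cast
      exact ⟨this.le, fun _ => this⟩
  have hstep2 : poissonCdf (m * a + r) (l + r) ≤ poissonCdf (m * a) l ∧
      (0 < r → poissonCdf (m * a + r) (l + r) < poissonCdf (m * a) l) := by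
    rw [← binPoissonCdf_one_add r (m * a) l]
    rcases r with _ | r
    · refine ⟨le_of_eq ?_, fun h => absurd h (lt_irrefl _)⟩
      rw [Nat.cast_zero, add_zero]
      rfl
    · have hl : 1 ≤ l := by
        have : (0 : ℝ) < l := by linarith
        exact_mod_cast this
      obtain ⟨n, rfl⟩ := Nat.exists_eq_add_of_le' hl
      have := poissonCdf_lt_binPoissonCdf (m := r) (k := n + r) one_pos le_rfl hAa
        (by push_cast at hk ⊢; linarith)
      rw [mul_one] at this
      rw [show n + 1 + (r + 1) = n + r + 2 by ring]
      push_cast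
      exact ⟨this.le, fun _ => this⟩
  rcases Nat.eq_zero_or_pos m with hm | hm
  · have hr : 0 < r := by
      rw [hm, Nat.cast_zero, zero_mul, zero_add] at hpos
      exact_mod_cast hpos
    exact (hstep2.2 hr).trans_le hstep1.1
  · exact hstep2.1.trans_lt (hstep1.2 hm)

/-! ### Assembly. -/

theorem mainTheorem7 {Ω : Type*} [MeasurableSpace Ω] (P : Measure Ω) [IsProbabilityMeasure P]
    (n : ℕ) (p : Fin n → unitInterval) (hp : ∀ i, 0 < p i ∧ p i < 1)
    (X : Fin n → Ω → ℕ)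
    (hX : ∀ i, HasLaw (X i) (bernoulliMeasure (1 : ℕ) 0 (p i)) P)
    (hindep : iIndepFun X P)
    (μ μ₂ : ℝ) (hμ : μ = ∫ ω, (trialSum X ω : ℝ) ∂P) (hμ₂ : μ₂ = ∑ i, (p i : ℝ) ^ 2)
    (k : ℤ) (x : ℝ) (hx : x = ((k : ℝ) - μ) / Real.sqrt μ) (hx1 : 1 ≤ x) :
    (2 ≤ k → P.real {ω | k ≤ (trialSum X ω : ℤ)} / poissonTail μ k - 1 < 0) ∧
    -(2 * poissonBinomialM μ μ₂ * (μ₂ / μ) *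
        (x ^ 2 + 1 + 4 * x * Real.sqrt ((1 - Real.exp (-μ)) / μ)))
      < P.real {ω | k ≤ (trialSum X ω : ℤ)} / poissonTail μ k - 1 := by
  have hp01 : ∀ i, 0 < (p i : ℝ) ∧ (p i : ℝ) < 1 := fun i => ⟨(hp i).1, (hp i).2⟩
  have hae : ∀ i, ∀ᵐ ω ∂P, X i ω = 0 ∨ X i ω = 1 := by
    intro i
    rw [(hX i).ae_iff (p := fun x => x = 0 ∨ x = 1) (by fun_prop), ae_iff]
    rw [bernoulliMeasure_apply_of_notMem_of_notMem] <;> simp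
  have hint : ∀ i, Integrable (fun ω => (X i ω : ℝ)) P := by
    intro i
    refine Integrable.of_bound (C := 1)
      (measurable_from_top.comp_aemeasurable (hX i).aemeasurable).aestronglyMeasurable ?_
    filter_upwards [hae i] with ω hω
    rcases hω with h | h <;> simp [h]
  have hmean : μ = ∑ i, (p i : ℝ) := by
    rw [hμ]
    simp only [trialSum, Nat.cast_sum]
    rw [integral_finsetSum _ fun i _ => hint i]
    refine Finset.sum_congr rfl fun i _ => ?_
    have h := (hX i).integral_comp (f := fun w : ℕ => (w : ℝ))
      measurable_from_top.aestronglyMeasurable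
    have h' : ∫ ω, (X i ω : ℝ) ∂P = ∫ w, (w : ℝ) ∂(bernoulliMeasure (1 : ℕ) 0 (p i)) := h
    rw [h', integral_bernoulliMeasure]
    simp
  have hn : (Finset.univ : Finset (Fin n)).Nonempty := by
    rw [Finset.univ_nonempty_iff]
    -- For `n = 0` one has `μ = 0`, and division by `√0` returns `x = 0`, contradicting `1 ≤ x`.
    by_contra hne
    rw [not_nonempty_iff] at hne
    rw [hmean] at hx
    simp at hx
    linarith
  have hμ0 : 0 < μ := hmean ▸ Finset.sum_pos (fun i _ => (hp01 i).1) hn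
  have hd : μ + Real.sqrt μ ≤ k := by
    rw [hx, le_div_iff₀ (Real.sqrt_pos.2 hμ0)] at hx1; linarith
  have hk0 : 0 ≤ k := by
    have : (0 : ℝ) < k := by linarith [Real.sqrt_nonneg μ]
    exact_mod_cast this.le
  lift k to ℕ using hk0
  rw [Int.cast_natCast] at hx hd
  have htail : P.real {ω | (k : ℤ) ≤ (trialSum X ω : ℤ)}
      = bernoulliExp Finset.univ (fun i => (p i : ℝ)) (fun w => if k ≤ w then 1 else 0) := by
    have h := measureReal_sum_bernoulli hX hindep Finset.univ {w | k ≤ w}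
    simp only [Set.mem_ofPred_eq] at h
    simp only [Nat.cast_le, trialSum]
    rw [h]
    congr!
  rw [htail, poissonTail_natCast hμ0.le]
  refine ⟨fun hk2 => ?_, bernoulliExp_tail_div_ge hn (fun i _ => hp01 i) hmean hμ₂ hx hx1⟩
  have hk2' : (2 : ℝ) ≤ k := by exact_mod_cast hk2
  -- For `μ ≤ 1` this is `k ≥ 2`; for `μ ≥ 1` it follows from `k ≥ μ + √μ`.
  have hμk : μ + 1 ≤ k := by
    rcases le_total μ 1 with h | h
    · linarith
    · linarith [Real.one_le_sqrt.2 h]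
  rw [sub_neg, div_lt_one (sub_pos.2 (poissonCdf_lt_one hμ0 k))]
  have hlt := poissonCdf_lt_bernoulliExp (fun i => ⟨(hp01 i).1.le, (hp01 i).2.le⟩)
    (hmean ▸ hμ0) (hmean ▸ hμk)
  rw [← hmean] at hlt
  have hcompl : (fun w : ℕ => if k ≤ w then (1 : ℝ) else 0)
      = fun w => 1 - if w < k then 1 else 0 := by
    ext w
    rcases lt_or_ge w k with h | h
    · simp [h, not_le.2 h]
    · simp [h, not_lt.2 h]
  rw [hcompl, bernoulliExp.sub, bernoulliExp.const]
  linarith
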